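/- Let $S$ and $X$ be complex manifolds (Hausdorff, second countable, finite-dimensional; not assumed connected). Let $\mathscr C(S,X)$ be the space of continuous maps $S\to X$ with the compact-open topology, and let $\mathscr O(S,X)\subset\mathscr C(S,X)$ be the subspace of holomorphic maps. For a topological space $P$ and a subspace $Q\subset P$, say that $(S,X)$ satisfies the \emph{parametric Oka property with respect to} $Q\hookrightarrow P$ if for every continuous map $f:P\to\mathscr C(S,X)$ with $f(Q)\subset\mathscr O(S,X)$ there is a continuous map $F:P\times[0,1]\to\mathscr C(S,X)$ such that $F(\cdot,0)=f$, $F(\cdot,t)|_Q=f|_Q$ for all $t\in[0,1]$, and $F(P\times\{1\})\subset\mathscr O(S,X)$. Then the following are equivalent. (i) $(S,X)$ satisfies the parametric Oka property with respect to every topological space $P$ and every subspace $Q$ of $P$. (ii) $\mathscr O(S,X)$ is a (strong) deformation retract of $\mathscr C(S,X)$: there is a homotopy, constant on $\mathscr O(S,X)$, from the identity map of $\mathscr C(S,X)$ to a retraction of $\mathscr C(S,X)$ onto $\mathscr O(S,X)$. (iii) The inclusion $\mathscr O(S,X)\hookrightarrow\mathscr C(S,X)$ is an acyclic cofibration in the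 h-structure of Strøm on the category of topological spaces, that is, it is a homotopy equivalence and a closed Hurewicz cofibration (a closed embedding with the homotopy extension property with respect to all spaces). (iii$'$) The inclusion $\mathscr O(S,X)\hookrightarrow\mathscr C(S,X)$ is an acyclic cofibration in the m-structure of Cole on the category of topological spaces, that is, it is a weak homotopy equivalence and has the left lifting property with respect to all Hurewicz fibrations that are weak homotopy equivalences. -/

import Mathlib

open CategoryTheory
open scoped Manifold unitInterval Topology

universe u v w

namespace OkaReformulation

/-! ### Spaces of continuous and holomorphic maps

A complex manifold modelled on a finite-dimensional complex normed space `E` is a `ChartedSpace E S`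
with `IsManifold 𝓘(ℂ, E) 1 S`: its transition maps are continuously differentiable over `ℂ`, that
is, holomorphic. A map between complex manifolds is holomorphic if it is `MDifferentiable` over
`ℂ`. -/

section Maps

/-- The set `𝒪(S, X)` of holomorphic maps in the space `𝒞(S, X)` of continuous maps; the latter
carries the compact-open topology, the former (as a subtype) the subspace topology. -/
def holomorphicMaps (E F : Type*) [NormedAddCommGroup E] [NormedSpace ℂ E]
    [NormedAddCommGroup F] [NormedSpace ℂ F]
    (S : Type u) [TopologicalSpace S] [ChartedSpace E S]
    (X : Type v) [TopologicalSpace X] [ChartedSpace F X] : Set C(S, X) :=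
  {f | MDifferentiable 𝓘(ℂ, E) 𝓘(ℂ, F) f}

/-- The parametric Oka property of `(S, X)` with respect to the inclusion of a subspace `Q` into a
parameter space `P`: every continuous `f : P → 𝒞(S, X)` that maps `Q` into `𝒪(S, X)` can be
deformed, keeping `f | Q` fixed, to a map with values in `𝒪(S, X)`. -/
def ParametricOka (E F : Type*) [NormedAddCommGroup E] [NormedSpace ℂ E]
    [NormedAddCommGroup F] [NormedSpace ℂ F]
    (S : Type u) [TopologicalSpace S] [ChartedSpace E S]
    (X : Type v) [TopologicalSpace X] [ChartedSpace F X]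
    (P : Type w) [TopologicalSpace P] (Q : Set P) : Prop :=
  ∀ f : C(P, C(S, X)), (∀ q ∈ Q, f q ∈ holomorphicMaps E F S X) →
    ∃ G : C(P × I, C(S, X)),
      (∀ p, G (p, 0) = f p) ∧
      (∀ q ∈ Q, ∀ t, G (q, t) = f q) ∧
      (∀ p, G (p, 1) ∈ holomorphicMaps E F S X)

/-- `A` is a deformation retract of `Y` (in the strong sense: the deformation keeps every point of
`A` fixed at all times). -/
def IsDeformationRetract {Y : Type u} [TopologicalSpace Y] (A : Set Y) : Prop :=
  ∃ r : C(Y, A), (∀ a : A, r a = a) ∧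
    (ContinuousMap.id Y).HomotopicRel
      ((⟨Subtype.val, continuous_subtype_val⟩ : C(A, Y)).comp r) A

/-- The inclusion of a subspace as a morphism of topological spaces. -/
def inclusion {Y : Type u} [TopologicalSpace Y] (A : Set Y) : TopCat.of A ⟶ TopCat.of Y :=
  TopCat.ofHom ⟨Subtype.val, continuous_subtype_val⟩

end Maps

/-! ### Weak homotopy equivalences -/

section Weak

variable {Y : Type u} {Z : Type v} [TopologicalSpace Y] [TopologicalSpace Z]

/-- The map `π_n(Y, y) → π_n(Z, g y)` induced by a continuous map `g`. -/
def piMap (g : C(Y, Z)) (n : ℕ) (y : Y) :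
    HomotopyGroup.Pi n Y y → HomotopyGroup.Pi n Z (g y) :=
  Quotient.map
    (fun γ : GenLoop (Fin n) Y y =>
      (⟨g.comp γ.1, fun t ht => congrArg g (γ.2 t ht)⟩ : GenLoop (Fin n) Z (g y)))
    (fun _ _ h => ContinuousMap.HomotopicRel.comp_continuousMap h g)

/-- The map on sets of path components induced by a continuous map. -/
def pathComponentsMap (g : C(Y, Z)) : ZerothHomotopy Y → ZerothHomotopy Z :=
  Quotient.map g (fun _ _ h => h.map g.continuous)

/-- A weak homotopy equivalence: a bijection on path components and on all homotopy groups at all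
base points. -/
def IsWeakHomotopyEquiv (g : C(Y, Z)) : Prop :=
  Function.Bijective (pathComponentsMap g) ∧
    ∀ n : ℕ, 1 ≤ n → ∀ y : Y, Function.Bijective (piMap g n y)

end Weak

/-! ### The h-structure and the m-structure on the category of topological spaces -/

section Model

/-- The homotopy equivalences: the weak equivalences of the h-structure. -/
def homotopyEquivalences : MorphismProperty TopCat.{u} := fun A B g =>
  ∃ e : ContinuousMap.HomotopyEquiv A B, e.toFun = g.hom

/-- The weak homotopy equivalences: the weak equivalences of the m-structure. -/
def weakHomotopyEquivalences : MorphismProperty TopCat.{u} := fun _ _ g =>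
  IsWeakHomotopyEquiv g.hom

/-- The Hurewicz fibrations (maps with the homotopy lifting property with respect to all spaces):
the fibrations of both the h-structure and the m-structure. -/
def hurewiczFibrations : MorphismProperty TopCat.{u} := fun A B g =>
  ∀ (W : TopCat.{u}) (f : C(W, A)) (H : C(W × I, B)), (∀ x, H (x, 0) = g.hom (f x)) →
    ∃ K : C(W × I, A), (∀ x, K (x, 0) = f x) ∧ ∀ z, g.hom (K z) = H z

/-- The cofibrations of the h-structure: the closed Hurewicz cofibrations, that is, the closed
embeddings with the homotopy extension property with respect to all spaces. -/
def hCofibrations : MorphismProperty TopCat.{u} := fun A B g =>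
  Topology.IsClosedEmbedding g.hom ∧
    ∀ (W : TopCat.{u}) (f : C(B, W)) (H : C(A × I, W)), (∀ a, H (a, 0) = f (g.hom a)) →
      ∃ K : C(B × I, W), (∀ b, K (b, 0) = f b) ∧ ∀ a t, K (g.hom a, t) = H (a, t)

/-- The cofibrations of the m-structure: the maps with the left lifting property with respect to
its acyclic fibrations, the Hurewicz fibrations that are weak homotopy equivalences. -/
def mCofibrations : MorphismProperty TopCat.{u} :=
  (hurewiczFibrations.{u} ⊓ weakHomotopyEquivalences.{u}).llp

/-- The acyclic cofibrations of the h-structure. -/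
def hAcyclicCofibrations : MorphismProperty TopCat.{u} :=
  hCofibrations.{u} ⊓ homotopyEquivalences.{u}

/-- The acyclic cofibrations of the m-structure. -/
def mAcyclicCofibrations : MorphismProperty TopCat.{u} :=
  mCofibrations.{u} ⊓ weakHomotopyEquivalences.{u}

end Model

end OkaReformulation

namespace OkaReformulation

/-! ### Weak homotopy equivalences and two-out-of-three. -/

section Weak

variable {Y : Type u} {Z : Type v} {W : Type w}
  [TopologicalSpace Y] [TopologicalSpace Z] [TopologicalSpace W]

/-! The Oka property for all `P`, `Q` amounts to its universal case, the identity of `𝒞(S, X)` with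
`Q = 𝒪(S, X)`; a deformation there is pulled back along any `f`. The remaining equivalences concern
an arbitrary subspace `A` of a metrizable space `Y`.

From a strong deformation retraction, the distance between `y` and its retract gives a continuous
function vanishing exactly on `A`. Reparametrizing the deformation by it makes each point arrive in
`A` at a continuously varying time (`exists_timed_deformation`); this yields both the homotopy
extension property and lifts against all Hurewicz fibrations.

Conversely, an acyclic m-cofibration lifts against the end point fibration of the space of paths
starting in `A`, which is a weak equivalence by two-out-of-three. Lifting the identity of `Y` gives
paths from `A` to each point, hence a deformation. For the h-structure, homotopy extension first
makes a homotopy inverse a retraction, then makes the homotopy to it constant on `A`. -/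

theorem homotopicRel_of_continuous {f₀ f₁ : C(Y, Z)} {A : Set Y} (H : I × Y → Z)
    (hH : Continuous H) (h0 : ∀ y, H (0, y) = f₀ y) (h1 : ∀ y, H (1, y) = f₁ y)
    (hA : ∀ t, ∀ y ∈ A, H (t, y) = f₀ y) : f₀.HomotopicRel f₁ A :=
  ⟨⟨⟨⟨H, hH⟩, h0, h1⟩, hA⟩⟩

/-! #### Change of base point -/

section Transport

variable {n : ℕ}

/-- The dilation of the cube by the factor `c` about its centre, cut off at the boundary. -/
noncomputable def cubeDilate (c : ℝ) (t : Fin n → I) : Fin n → I :=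
  fun i => Set.projIcc 0 1 zero_le_one (c * ((t i : ℝ) - 1 / 2) + 1 / 2)

/-- The norm on the cube whose unit ball is the whole cube. -/
noncomputable def cubeNorm (t : Fin n → I) : ℝ := ‖fun i => 2 * (t i : ℝ) - 1‖

/-- Transport of a generalized loop along a path: the loop is shrunk to the inner half of the cube,
and the path is run through radially in the outer half. -/
noncomputable def transport {α : Type*} (δ : I → α) (γ : (Fin n → I) → α) (t : Fin n → I) : α :=
  if cubeNorm t ≤ 1 / 2 then γ (cubeDilate 2 t)
  else δ (Set.projIcc 0 1 zero_le_one (2 * cubeNorm t - 1))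

theorem continuous_cubeNorm : Continuous (cubeNorm (n := n)) := by
  unfold cubeNorm; fun_prop

theorem continuous_cubeDilate : Continuous fun p : ℝ × (Fin n → I) => cubeDilate p.1 p.2 := by
  unfold cubeDilate
  exact continuous_pi fun i => continuous_projIcc.comp (by fun_prop)

theorem cubeDilate_one (t : Fin n → I) : cubeDilate 1 t = t := by
  funext i
  have : (1 : ℝ) * ((t i : ℝ) - 1 / 2) + 1 / 2 = t i := by ring
  simp only [cubeDilate, this, Set.projIcc_val]

theorem cubeDilate_mem_boundary {c : ℝ} (hc : 1 ≤ c) {t : Fin n → I}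
    (ht : t ∈ Cube.boundary (Fin n)) : cubeDilate c t ∈ Cube.boundary (Fin n) := by
  obtain ⟨i, hi⟩ := ht
  refine ⟨i, hi.imp (fun h => ?_) (fun h => ?_)⟩
  · exact Set.projIcc_of_le_left _ (by rw [h]; simp; linarith)
  · exact Set.projIcc_of_right_le _ (by rw [h]; simp; linarith)

theorem cubeDilate_two_mem_boundary {t : Fin n → I} (ht : 1 / 2 ≤ cubeNorm t) :
    cubeDilate 2 t ∈ Cube.boundary (Fin n) := by
  obtain ⟨i, hi⟩ : ∃ i, 1 / 2 ≤ |2 * (t i : ℝ) - 1| := by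
    by_contra! h
    exact ht.not_gt ((pi_norm_lt_iff (by norm_num)).2 h)
  refine ⟨i, ?_⟩
  rcases le_abs.1 hi with h | h
  · exact Or.inr (Set.projIcc_of_right_le _ (by linarith))
  · exact Or.inl (Set.projIcc_of_le_left _ (by linarith))

theorem one_le_cubeNorm {t : Fin n → I} (ht : t ∈ Cube.boundary (Fin n)) : 1 ≤ cubeNorm t := by
  obtain ⟨i, hi⟩ := ht
  refine le_trans ?_ (norm_le_pi_norm (fun i => 2 * (t i : ℝ) - 1) i)
  rcases hi with h | h <;> simp [h]; norm_num

theorem transport_of_mem_boundary {α : Type*} (δ : I → α) (γ : (Fin n → I) → α) {t : Fin n → I}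
    (ht : t ∈ Cube.boundary (Fin n)) : transport δ γ t = δ 1 := by
  have := one_le_cubeNorm ht
  rw [transport, if_neg (by linarith), Set.projIcc_of_right_le _ (by linarith)]
  rfl

theorem comp_transport {α β : Type*} (g : α → β) (δ : I → α) (γ : (Fin n → I) → α) :
    g ∘ transport δ γ = transport (g ∘ δ) (g ∘ γ) := by
  funext t
  simp only [transport, Function.comp_apply]
  split_ifs <;> rfl

/-- The branches agree where `cubeNorm t = 1 / 2`, since dilation by 2 sends such points to the
boundary. Letting path and loop depend on `w` yields the homotopies below. -/
theorem continuous_transport {δ : W → I → Y} {γ : W → (Fin n → I) → Y}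
    (hδ : Continuous fun p : W × I => δ p.1 p.2)
    (hγ : Continuous fun p : W × (Fin n → I) => γ p.1 p.2)
    (h : ∀ w, ∀ t ∈ Cube.boundary (Fin n), γ w t = δ w 0) :
    Continuous fun p : W × (Fin n → I) => transport (δ p.1) (γ p.1) p.2 := by
  refine Continuous.if_le ?_ ?_ (continuous_cubeNorm.comp continuous_snd) continuous_const ?_
  · exact hγ.comp (continuous_fst.prodMk
      (continuous_cubeDilate.comp (continuous_const.prodMk continuous_snd)))
  · have h1 : Continuous fun p : W × (Fin n → I) => 2 * cubeNorm p.2 - 1 :=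
      (continuous_const.mul (continuous_cubeNorm.comp continuous_snd)).sub continuous_const
    exact hδ.comp (continuous_fst.prodMk ((continuous_projIcc (h := zero_le_one)).comp h1))
  · rintro ⟨w, t⟩ ht
    have ht' : cubeNorm t = 1 / 2 := ht
    rw [h w _ (cubeDilate_two_mem_boundary ht'.ge), Set.projIcc_of_le_left _ (by simp [ht'])]
    rfl

theorem continuous_transport_of_const {δ : C(I, Y)} {γ : C(Fin n → I, Y)}
    (h : ∀ t ∈ Cube.boundary (Fin n), γ t = δ 0) : Continuous (transport δ γ) :=
  (continuous_transport (W := Unit) (δ := fun _ => δ) (γ := fun _ => γ) (by fun_prop)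
    (by fun_prop) fun _ => h).comp (continuous_const.prodMk continuous_id : Continuous (Prod.mk ()))

/-- The transport of a continuous map on the cube that is constant on the boundary. -/
noncomputable def transportMap (δ : C(I, Y)) (γ : C(Fin n → I, Y))
    (h : ∀ t ∈ Cube.boundary (Fin n), γ t = δ 0) : C(Fin n → I, Y) :=
  ⟨transport δ γ, continuous_transport_of_const h⟩

theorem transportMap_homotopicRel {δ : C(I, Y)} {γ γ' : C(Fin n → I, Y)}
    (h : ∀ t ∈ Cube.boundary (Fin n), γ t = δ 0) (h' : ∀ t ∈ Cube.boundary (Fin n), γ' t = δ 0)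
    (H : γ.HomotopicRel γ' (Cube.boundary (Fin n))) :
    (transportMap δ γ h).HomotopicRel (transportMap δ γ' h') (Cube.boundary (Fin n)) := by
  obtain ⟨H⟩ := H
  refine homotopicRel_of_continuous (fun p => transport δ (fun t => H (p.1, t)) p.2) ?_ ?_ ?_ ?_
  · exact continuous_transport (δ := fun _ => δ) (γ := fun s t => H (s, t)) (by fun_prop)
      H.continuous fun s t ht => (H.eq_fst s ht).trans (h t ht)
  · intro t; simp [transportMap]
  · intro t; simp [transportMap]
  · intro s t ht
    exact (transport_of_mem_boundary _ _ ht).trans (transport_of_mem_boundary _ _ ht).symm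

theorem transport_const {α : Type*} {y : α} {γ : (Fin n → I) → α}
    (h : ∀ t ∈ Cube.boundary (Fin n), γ t = y) (t : Fin n → I) :
    transport (fun _ => y) γ t = γ (cubeDilate 2 t) := by
  rw [transport]
  split_ifs with ht
  · rfl
  · rw [h _ (cubeDilate_two_mem_boundary (not_le.1 ht).le)]

/-- Along a constant path, transport is just the dilation by 2, so a dilation factor growing from 1
to 2 gives the homotopy. -/
theorem homotopicRel_transportMap_const {y : Y} {γ : C(Fin n → I, Y)}
    (h : ∀ t ∈ Cube.boundary (Fin n), γ t = y) :
    γ.HomotopicRel (transportMap (ContinuousMap.const I y) γ h) (Cube.boundary (Fin n)) := by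
  refine homotopicRel_of_continuous (fun p => γ (cubeDilate (1 + (p.1 : ℝ)) p.2)) ?_ ?_ ?_ ?_
  · exact γ.continuous.comp (continuous_cubeDilate.comp
      (f := fun p : I × (Fin n → I) => (1 + (p.1 : ℝ), p.2)) (by fun_prop))
  · intro t; simp [cubeDilate_one]
  · intro t
    have := transport_const h t
    simp only [transportMap, ContinuousMap.coe_mk]
    refine Eq.trans ?_ this.symm
    norm_num
  · intro s t ht
    rw [h t ht, h _ (cubeDilate_mem_boundary (by linarith [s.2.1]) ht)]

/-- The reverse of a path. -/
def revPath (δ : C(I, Y)) : C(I, Y) := ⟨fun s => δ (σ s), by fun_prop⟩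

/-- Transport along a path and back does not change the homotopy class of a loop. -/
theorem homotopicRel_transportMap_rev {δ : C(I, Y)} {γ : C(Fin n → I, Y)}
    (h : ∀ t ∈ Cube.boundary (Fin n), γ t = δ 0)
    (h' : ∀ t ∈ Cube.boundary (Fin n), transportMap δ γ h t = revPath δ 0) :
    γ.HomotopicRel (transportMap (revPath δ) (transportMap δ γ h) h')
      (Cube.boundary (Fin n)) := by
  have hc := homotopicRel_transportMap_const h
  have h1 : ∀ t ∈ Cube.boundary (Fin n),
      transportMap (ContinuousMap.const I (δ 0)) γ h t = δ 0 :=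
    fun t ht => transport_of_mem_boundary _ _ ht
  refine (hc.trans (homotopicRel_transportMap_const h1)).trans ?_
  -- At stage `p`, go along `δ` only up to time `p` and return. Stage 0 is transport twice along the
  -- constant path, stage 1 the full round trip.
  refine homotopicRel_of_continuous (fun p => transport (fun s => δ (min p.1 (σ s)))
    (transport (fun s => δ (min p.1 s)) γ) p.2) ?_ ?_ ?_ ?_
  · refine continuous_transport (δ := fun p s => δ (min p (σ s)))
      (γ := fun p => transport (fun s => δ (min p s)) γ) (by fun_prop) ?_ ?_
    · exact continuous_transport (δ := fun p s => δ (min p s)) (γ := fun _ => γ) (by fun_prop)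
        (by fun_prop) fun p t ht => by
          rw [h t ht, min_eq_right (show (0 : I) ≤ p from p.2.1)]
    · intro p t ht
      rw [transport_of_mem_boundary _ _ ht]
      simp
  · intro t
    have h0 : ∀ s : I, min 0 s = 0 := fun s => min_eq_left s.2.1
    simp only [transportMap, ContinuousMap.coe_mk, h0]
    rfl
  · intro t
    have h0 : ∀ s : I, min 1 s = s := fun s => min_eq_right s.2.2
    simp only [transportMap, ContinuousMap.coe_mk, h0]
    rfl
  · intro s t ht
    refine (transport_of_mem_boundary _ _ ht).trans ?_
    refine Eq.trans ?_ (transport_of_mem_boundary _ _ ht).symm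
    simp

end Transport

/-! #### Bijectivity on homotopy groups -/

variable (g : C(Y, Z)) (n : ℕ) (y : Y)

/-- The map induced by `g` on the `n`-th homotopy groups at `y` is bijective, expressed in terms of
representatives. -/
def PiBijective : Prop :=
  (∀ γ γ' : C(Fin n → I, Y), (∀ t ∈ Cube.boundary (Fin n), γ t = y) →
    (∀ t ∈ Cube.boundary (Fin n), γ' t = y) →
    (g.comp γ).HomotopicRel (g.comp γ') (Cube.boundary (Fin n)) →
    γ.HomotopicRel γ' (Cube.boundary (Fin n))) ∧
  ∀ μ : C(Fin n → I, Z), (∀ t ∈ Cube.boundary (Fin n), μ t = g y) →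
    ∃ γ : C(Fin n → I, Y), (∀ t ∈ Cube.boundary (Fin n), γ t = y) ∧
      (g.comp γ).HomotopicRel μ (Cube.boundary (Fin n))

theorem bijective_piMap_iff : Function.Bijective (piMap g n y) ↔ PiBijective g n y := by
  refine and_congr ⟨fun h γ γ' hγ hγ' H => ?_, fun h => ?_⟩ ⟨fun h μ hμ => ?_, fun h => ?_⟩
  · have := @h (Quotient.mk _ ⟨γ, hγ⟩) (Quotient.mk _ ⟨γ', hγ'⟩) (Quotient.sound H)
    exact Quotient.exact this
  · rintro ⟨γ, hγ⟩ ⟨γ', hγ'⟩ H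
    exact Quotient.sound (h γ γ' hγ hγ' (Quotient.exact H))
  · obtain ⟨⟨γ, hγ⟩, H⟩ := h (Quotient.mk _ ⟨μ, hμ⟩)
    exact ⟨γ, hγ, Quotient.exact H⟩
  · rintro ⟨μ, hμ⟩
    obtain ⟨γ, hγ, H⟩ := h μ hμ
    exact ⟨Quotient.mk _ ⟨γ, hγ⟩, Quotient.sound H⟩

variable {g n y}

/-- Transport commutes with composition by `g` and is undone, up to homotopy, by transport along the
reversed path. -/
theorem PiBijective.of_path {δ : C(I, Y)} (h : PiBijective g n (δ 1)) :
    PiBijective g n (δ 0) := by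
  have comp_eq : ∀ (ε : C(I, Y)) (γ : C(Fin n → I, Y))
      (hγ : ∀ t ∈ Cube.boundary (Fin n), γ t = ε 0),
      g.comp (transportMap ε γ hγ) =
        transportMap (g.comp ε) (g.comp γ) (fun t ht => congrArg g (hγ t ht)) :=
    fun ε γ hγ => ContinuousMap.coe_injective (comp_transport g ε γ)
  have bd : ∀ (γ : C(Fin n → I, Y)) (hγ : ∀ t ∈ Cube.boundary (Fin n), γ t = δ 0),
      ∀ t ∈ Cube.boundary (Fin n), transportMap δ γ hγ t = revPath δ 0 :=
    fun γ hγ t ht => (transport_of_mem_boundary _ _ ht).trans (by simp [revPath])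
  refine ⟨fun γ γ' hγ hγ' H => ?_, fun μ hμ => ?_⟩
  · have H1 := transportMap_homotopicRel (δ := g.comp δ) (fun t ht => congrArg g (hγ t ht))
      (fun t ht => congrArg g (hγ' t ht)) H
    rw [← comp_eq δ γ hγ, ← comp_eq δ γ' hγ'] at H1
    have H2 := h.1 _ _ (fun t ht => transport_of_mem_boundary _ _ ht)
      (fun t ht => transport_of_mem_boundary _ _ ht) H1
    exact ((homotopicRel_transportMap_rev hγ (bd γ hγ)).trans
      (transportMap_homotopicRel (bd γ hγ) (bd γ' hγ') H2)).trans
      (homotopicRel_transportMap_rev hγ' (bd γ' hγ')).symm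
  · obtain ⟨γ, hγ, H⟩ := h.2 (transportMap (g.comp δ) μ hμ)
      (fun t ht => transport_of_mem_boundary _ _ ht)
    have hγ1 : ∀ t ∈ Cube.boundary (Fin n), γ t = revPath δ 0 :=
      fun t ht => (hγ t ht).trans (by simp [revPath])
    refine ⟨transportMap (revPath δ) γ hγ1,
      fun t ht => (transport_of_mem_boundary _ _ ht).trans (by simp [revPath]), ?_⟩
    have bd' : ∀ t ∈ Cube.boundary (Fin n),
        transportMap (g.comp δ) μ hμ t = revPath (g.comp δ) 0 :=
      fun t ht => (transport_of_mem_boundary _ _ ht).trans (by simp [revPath])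
    rw [comp_eq]
    exact (transportMap_homotopicRel (δ := revPath (g.comp δ)) _ bd' H).trans
      (homotopicRel_transportMap_rev hμ bd').symm

/-- If `g ∘ c` and `c` induce bijections on homotopy groups, then so does `g` at the base points in
the image of `c`. -/
theorem PiBijective.of_comp {c : C(W, Y)} {x : W} (hc : PiBijective c n x)
    (hgc : PiBijective (g.comp c) n x) : PiBijective g n (c x) := by
  refine ⟨fun γ γ' hγ hγ' H => ?_, fun μ hμ => ?_⟩
  · obtain ⟨α, hα, Hα⟩ := hc.2 γ hγ
    obtain ⟨α', hα', Hα'⟩ := hc.2 γ' hγ'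
    have := hgc.1 α α' hα hα' (((Hα.comp_continuousMap g).trans H).trans
      (Hα'.comp_continuousMap g).symm)
    exact (Hα.symm.trans (this.comp_continuousMap c)).trans Hα'
  · obtain ⟨α, hα, Hα⟩ := hgc.2 μ hμ
    exact ⟨c.comp α, fun t ht => congrArg c (hα t ht), Hα⟩

variable (g) in
theorem bijective_pathComponentsMap_iff : Function.Bijective (pathComponentsMap g) ↔
    (∀ x y, Joined (g x) (g y) → Joined x y) ∧ ∀ z, ∃ y, Joined (g y) z := by
  refine and_congr ⟨fun h x y H => ?_, fun h => ?_⟩ ⟨fun h z => ?_, fun h => ?_⟩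
  · exact Quotient.exact (@h (Quotient.mk _ x) (Quotient.mk _ y) (Quotient.sound H))
  · rintro ⟨x⟩ ⟨y⟩ H
    exact Quotient.sound (h x y (Quotient.exact H))
  · obtain ⟨⟨y⟩, H⟩ := h (Quotient.mk _ z)
    exact ⟨y, Quotient.exact H⟩
  · rintro ⟨z⟩
    obtain ⟨y, H⟩ := h z
    exact ⟨Quotient.mk _ y, Quotient.sound H⟩

/-- The inclusion of a strong deformation retract is a weak homotopy equivalence. -/
theorem isWeakHomotopyEquiv_of_deformation {c : C(Y, Z)} {r : C(Z, Y)} (hr : ∀ y, r (c y) = y)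
    (H : (ContinuousMap.id Z).HomotopicRel (c.comp r) (Set.range c)) :
    IsWeakHomotopyEquiv c := by
  obtain ⟨H⟩ := H
  constructor
  · rw [bijective_pathComponentsMap_iff]
    refine ⟨fun x y h => ?_, fun z => ⟨r z, ?_⟩⟩
    · have := h.map r.continuous
      rwa [hr, hr] at this
    · exact Joined.symm ⟨⟨⟨fun t => H (t, z), by fun_prop⟩, by simp, by simp⟩⟩
  · intro n _ y
    rw [bijective_piMap_iff]
    refine ⟨fun γ γ' _ _ h => ?_, fun μ hμ => ⟨r.comp μ, fun t ht => ?_, ?_⟩⟩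
    · have := h.comp_continuousMap r
      rwa [← ContinuousMap.comp_assoc, ← ContinuousMap.comp_assoc,
        show r.comp c = ContinuousMap.id Y from ContinuousMap.ext hr,
        ContinuousMap.id_comp, ContinuousMap.id_comp] at this
    · simp [hμ t ht, hr]
    · refine ContinuousMap.HomotopicRel.symm
        (homotopicRel_of_continuous (fun p => H (p.1, μ p.2)) (by fun_prop) ?_ ?_ ?_)
      · intro t; simp
      · intro t; simp
      · intro s t ht
        exact H.eq_fst s (hμ t ht ▸ Set.mem_range_self y)

/-- If `c` and `g ∘ c` are weak homotopy equivalences, then so is `g`. -/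
theorem isWeakHomotopyEquiv_of_comp {c : C(W, Y)} (hc : IsWeakHomotopyEquiv c)
    (hgc : IsWeakHomotopyEquiv (g.comp c)) : IsWeakHomotopyEquiv g := by
  have hc0 := (bijective_pathComponentsMap_iff c).1 hc.1
  have hgc0 := (bijective_pathComponentsMap_iff (g.comp c)).1 hgc.1
  constructor
  · rw [bijective_pathComponentsMap_iff]
    refine ⟨fun x y h => ?_, fun z => ?_⟩
    · obtain ⟨a, ha⟩ := hc0.2 x
      obtain ⟨b, hb⟩ := hc0.2 y
      have := hgc0.1 a b (((ha.map g.continuous).trans h).trans (hb.map g.continuous).symm)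
      exact (ha.symm.trans (this.map c.continuous)).trans hb
    · obtain ⟨a, ha⟩ := hgc0.2 z
      exact ⟨c a, ha⟩
  · intro n hn y
    -- The point `y` need not lie in the image of `c`; it is joined to some `c a`, and the base
    -- point is moved along the path.
    obtain ⟨a, ⟨δ⟩⟩ := hc0.2 y
    have h := PiBijective.of_comp ((bijective_piMap_iff _ _ _).1 (hc.2 n hn a))
      ((bijective_piMap_iff _ _ _).1 (hgc.2 n hn a))
    rw [bijective_piMap_iff]
    have := PiBijective.of_path (δ := δ.symm.toContinuousMap) (g := g) (n := n)
      (by simpa using h)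
    simpa using this

end Weak

/-! ### Strong deformation retracts of metrizable spaces. -/

section Deformation

variable {Y : Type u} [TopologicalSpace Y] {A : Set Y}

/-- Reparametrizing a deformation that is constant on the zero set of `d` so that the point `y` is
moved at speed `1 / d y` gives a continuous map. -/
theorem continuous_reparam {H : I × Y → Y} (hH : Continuous H) {d : Y → ℝ} (hd : Continuous d)
    (hfix : ∀ y, d y = 0 → ∀ t, H (t, y) = y) :
    Continuous fun q : Y × ℝ => H (Set.projIcc 0 1 zero_le_one (q.2 / d q.1), q.1) := by
  rw [continuous_iff_continuousAt]
  rintro ⟨y, s⟩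
  by_cases hy : d y = 0
  · intro V hV
    simp only [hfix y hy] at hV
    -- The quotient `s / d` is uncontrolled near a zero of `d`, but compactness of `I` keeps `H (t,
    -- z)` in `V` for all `t` at once.
    have := (isCompact_univ (X := I)).eventually_forall_of_forall_eventually (x₀ := y)
      (P := fun z t => H (t, z) ∈ V) fun t _ => by
        have h1 : ContinuousAt (fun z : Y × I => H (z.2, z.1)) (y, t) := by fun_prop
        exact h1 (by simpa only [hfix y hy] using hV)
    rw [Filter.mem_map, nhds_prod_eq]
    filter_upwards [this.prod_inl (𝓝 s)] with q hq
    exact hq _ trivial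
  · have h1 : ContinuousAt (fun q : Y × ℝ => q.2 / d q.1) (y, s) :=
      ContinuousAt.div (by fun_prop) (by fun_prop) hy
    have h2 : ContinuousAt (fun q : Y × ℝ =>
        (Set.projIcc (0 : ℝ) 1 zero_le_one (q.2 / d q.1), q.1)) (y, s) :=
      ((continuous_projIcc (h := zero_le_one)).continuousAt.comp h1).prodMk continuousAt_fst
    exact hH.continuousAt.comp h2

/-- A strong deformation retract of a metrizable space admits a deformation that reaches the
subspace at a time depending continuously on the point. -/
theorem IsDeformationRetract.exists_timed_deformation [TopologicalSpace.MetrizableSpace Y]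
    (hA : IsDeformationRetract A) :
    ∃ (r : C(Y, A)) (D : C(Y × ℝ, Y)) (d : C(Y, I)), (∀ a : A, r a = a) ∧
      (∀ a : A, d a = 0) ∧ (∀ y, D (y, 0) = y) ∧ (∀ y, D (y, (d y : ℝ)) = r y) ∧
      ∀ (a : A) t, D (a, t) = a := by
  obtain ⟨r, hr, ⟨H⟩⟩ := hA
  let := TopologicalSpace.metrizableSpaceMetric Y
  -- Since `r y` lies in `A`, this function vanishes exactly on `A`; the cap at 1 makes it a time in
  -- `I`.
  have hd : Continuous fun y : Y => min 1 (dist y (r y : Y)) := by fun_prop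
  have hzero : ∀ y, min 1 (dist y (r y : Y)) = 0 → y ∈ A := fun y hy => by
    have h1 : dist y (r y : Y) = 0 := by
      rcases min_choice 1 (dist y (r y : Y)) with h | h
      · rw [h] at hy; norm_num at hy
      · rwa [h] at hy
    rw [dist_eq_zero.1 h1]
    exact (r y).2
  have hfix : ∀ y ∈ A, ∀ t, H (t, y) = y := fun y hy t => H.eq_fst t hy
  refine ⟨r, ⟨_, continuous_reparam H.continuous hd fun y hy => hfix y (hzero y hy)⟩,
    ⟨fun y => ⟨min 1 (dist y (r y : Y)), le_min zero_le_one dist_nonneg, min_le_left _ _⟩,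
      hd.subtype_mk _⟩, hr, fun a => ?_, fun y => ?_, fun y => ?_, fun a t => hfix a a.2 _⟩
  · ext; simp [hr a]
  · simp only [ContinuousMap.coe_mk, zero_div, Set.projIcc_left]
    exact H.apply_zero y
  · by_cases hy : min 1 (dist y (r y : Y)) = 0
    · have hyA := hzero y hy
      simp only [ContinuousMap.coe_mk]
      rw [hfix y hyA]
      exact congrArg Subtype.val (hr ⟨y, hyA⟩).symm
    · simp only [ContinuousMap.coe_mk]
      rw [div_self hy, Set.projIcc_right]
      exact H.apply_one y

/-- The inclusion of a strong deformation retract of a metrizable space has the left lifting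
property with respect to all Hurewicz fibrations. -/
theorem IsDeformationRetract.exists_lift [TopologicalSpace.MetrizableSpace Y]
    (hA : IsDeformationRetract A) {M B : TopCat.{u}} {p : M ⟶ B} (hp : hurewiczFibrations p)
    (f : C(A, M)) (g : C(Y, B)) (h : ∀ a, p.hom (f a) = g a) :
    ∃ l : C(Y, M), (∀ a : A, l a = f a) ∧ ∀ y, p.hom (l y) = g y := by
  obtain ⟨r, D, d, hr, hd, hD0, hD1, -⟩ := hA.exists_timed_deformation
  -- The deformation run backwards from `r y` reaches `y` at time `d y`; lifting it from `f (r y)`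
  -- and evaluating there gives the lift. On `A` this time is 0.
  obtain ⟨K, hK0, hK⟩ := hp (TopCat.of Y) (f.comp r)
    ⟨fun q : Y × I => g (D (q.1, (d q.1 : ℝ) - q.2)), by fun_prop⟩ (fun y => by
      simp [hD1, h])
  refine ⟨⟨fun y => K (y, d y), by fun_prop⟩, fun a => ?_, fun y => ?_⟩
  · have := hK0 (a : Y)
    simp only [ContinuousMap.coe_mk, hd]
    rw [this]
    simp [hr]
  · simp [hK, hD0]

/-- Apply `f` along the deformation until `y` reaches `r y` at time `d y`, then follow `H` at `r y`
for the remaining time. On `A` the first stage has length 0. Closedness holds because `A` is the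
fixed-point set of `r`. -/
theorem IsDeformationRetract.hCofibrations [TopologicalSpace.MetrizableSpace Y]
    (hA : IsDeformationRetract A) : hCofibrations (inclusion A) := by
  obtain ⟨r, D, d, hr, hd, hD0, hD1, hDA⟩ := hA.exists_timed_deformation
  refine ⟨Topology.IsClosedEmbedding.subtypeVal ?_, fun W f H h => ?_⟩
  · have : A = {y | (r y : Y) = y} := by
      ext y
      exact ⟨fun hy => congrArg Subtype.val (hr ⟨y, hy⟩), fun hy => hy ▸ (r y).2⟩
    rw [this]
    exact isClosed_eq (by fun_prop) continuous_id
  · have hcont : Continuous fun q : Y × I => if (q.2 : ℝ) ≤ (d q.1 : ℝ) then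
        f (D (q.1, (q.2 : ℝ))) else H (r q.1, Set.projIcc 0 1 zero_le_one ((q.2 : ℝ) - d q.1)) := by
      refine Continuous.if_le (α := ℝ) ?_ ?_ ?_ ?_ ?_
      · exact f.continuous.comp (D.continuous.comp (by fun_prop))
      · have h1 : Continuous fun q : Y × I => (q.2 : ℝ) - d q.1 := by fun_prop
        exact H.continuous.comp ((r.continuous.comp continuous_fst).prodMk
          ((continuous_projIcc (h := zero_le_one)).comp h1))
      · fun_prop
      · fun_prop
      · rintro ⟨y, t⟩ ht
        have ht' : (t : ℝ) = d y := ht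
        simp only [ht', sub_self, Set.projIcc_left, hD1]
        exact (h (r y)).symm
    refine ⟨⟨_, hcont⟩, fun y => ?_, fun a t => ?_⟩
    · simp [hD0]
    · change (if (t : ℝ) ≤ d (a : Y) then f (D ((a : Y), (t : ℝ)))
        else H (r (a : Y), Set.projIcc 0 1 zero_le_one ((t : ℝ) - d (a : Y)))) = H (a, t)
      rw [hd a, hr a, hDA]
      split_ifs with ht
      · have : t = 0 := le_antisymm ht t.2.1
        rw [this]
        exact (h a).symm
      · simp

theorem IsDeformationRetract.homotopyEquivalences (hA : IsDeformationRetract A) :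
    homotopyEquivalences (inclusion A) := by
  obtain ⟨r, hr, H⟩ := hA
  refine ⟨⟨(inclusion A).hom, r, ?_, H.homotopic.symm⟩, rfl⟩
  rw [show r.comp (inclusion A).hom = ContinuousMap.id A from ContinuousMap.ext hr]

theorem IsDeformationRetract.weakHomotopyEquivalences (hA : IsDeformationRetract A) :
    weakHomotopyEquivalences (inclusion A) := by
  obtain ⟨r, hr, H⟩ := hA
  refine isWeakHomotopyEquiv_of_deformation (Y := A) (Z := Y) (c := (inclusion A).hom)
    (r := r) hr ?_
  convert! H
  exact Subtype.range_coe

theorem IsDeformationRetract.mCofibrations [TopologicalSpace.MetrizableSpace Y]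
    (hA : IsDeformationRetract A) : mCofibrations (inclusion A) := by
  refine fun M B p hp => ⟨fun {f g} sq => ?_⟩
  obtain ⟨l, hl, hl'⟩ := hA.exists_lift hp.1 f.hom g.hom fun a => congr($(sq.w).hom a)
  exact ⟨⟨⟨TopCat.ofHom l, by ext a; exact hl a, by ext y; exact hl' y⟩⟩⟩

/-! ### The mapping path space -/

variable (A) in
/-- The space of paths in `Y` that start in `A`. -/
abbrev pathsFrom : Type u := {q : A × C(I, Y) // q.2 0 = q.1}

/-- The end point of a path starting in `A`. -/
def endPoint : C(pathsFrom A, Y) := ⟨fun q => q.1.2 1, by fun_prop⟩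

/-- The constant path at a point of `A`. -/
def constPath : C(A, pathsFrom A) :=
  ⟨fun a => ⟨(a, ContinuousMap.const I (a : Y)), rfl⟩, by
    refine (continuous_id.prodMk ?_).subtype_mk _
    exact ContinuousMap.continuous_const'.comp continuous_subtype_val⟩

theorem continuous_pathsFrom_mk {Z : Type*} [TopologicalSpace Z] {a : Z → A} (ha : Continuous a)
    {γ : Z × I → Y} (hγ : Continuous γ) (h : ∀ z, γ (z, 0) = a z) :
    Continuous fun z : Z =>
      (⟨(a z, ⟨fun s => γ (z, s), by fun_prop⟩), h z⟩ : pathsFrom A) :=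
  (ha.prodMk (ContinuousMap.curry ⟨γ, hγ⟩).continuous).subtype_mk _

/-- Every path shrinks to its starting point. -/
theorem isWeakHomotopyEquiv_constPath : IsWeakHomotopyEquiv (constPath (A := A)) := by
  refine isWeakHomotopyEquiv_of_deformation (r := ⟨fun q => q.1.1, by fun_prop⟩) (fun _ => rfl) ?_
  refine homotopicRel_of_continuous
    (fun z => ⟨(z.2.1.1, ⟨fun s => z.2.1.2 (s * σ z.1), by fun_prop⟩), by
      simpa using z.2.2⟩) ?_ ?_ ?_ ?_
  · exact continuous_pathsFrom_mk (a := fun z : I × pathsFrom A => z.2.1.1) (by fun_prop)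
      (γ := fun z : (I × pathsFrom A) × I => z.1.2.1.2 (z.2 * σ z.1.1)) (by fun_prop) _
  · intro q
    ext <;> simp
  · intro q
    ext s
    · simp [constPath]
    · simpa [constPath] using q.2
  · rintro t _ ⟨a, rfl⟩
    ext <;> simp [constPath]

/-- The end point projection is a Hurewicz fibration. -/
theorem hurewiczFibrations_endPoint :
    hurewiczFibrations (TopCat.ofHom (endPoint (A := A))) := by
  intro W f H h
  have h' : ∀ x, H (x, 0) = (f x).1.2 1 := h
  -- The lift at time `t` is the path of `f x` followed by `H (x, ·)` up to time `t`, at speed `1 +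
  -- t`; it ends at `H (x, t)` and is the given path when `t = 0`.
  have hγ : Continuous fun z : (W × I) × I =>
      if (z.2 : ℝ) * (1 + z.1.2) ≤ 1 then
        (f z.1.1).1.2 (Set.projIcc 0 1 zero_le_one ((z.2 : ℝ) * (1 + z.1.2)))
      else H (z.1.1, Set.projIcc 0 1 zero_le_one ((z.2 : ℝ) * (1 + z.1.2) - 1)) := by
    have h1 : Continuous fun z : (W × I) × I => (z.2 : ℝ) * (1 + z.1.2) := by fun_prop
    have h2 : Continuous fun z : (W × I) × I => (z.2 : ℝ) * (1 + z.1.2) - 1 := by fun_prop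
    have h3 := (continuous_projIcc (a := (0 : ℝ)) (b := 1) (h := zero_le_one)).comp h1
    have h4 := (continuous_projIcc (a := (0 : ℝ)) (b := 1) (h := zero_le_one)).comp h2
    have hf : Continuous fun z : (W × I) × I => (f z.1.1).1.2 := by
      have : Continuous fun z : (W × I) × I => f z.1.1 := by fun_prop
      exact continuous_snd.comp (continuous_subtype_val.comp this)
    refine Continuous.if_le (hf.eval h3)
      (H.continuous.comp ((continuous_fst.comp continuous_fst).prodMk h4)) h1 continuous_const ?_
    intro z hz
    simp only [hz, sub_self, Set.projIcc_left, Set.projIcc_right]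
    exact (h' z.1.1).symm
  have h0 : ∀ z : W × I, (if (((0 : I) : ℝ)) * (1 + z.2) ≤ 1 then
        (f z.1).1.2 (Set.projIcc 0 1 zero_le_one (((0 : I) : ℝ) * (1 + z.2)))
      else H (z.1, Set.projIcc 0 1 zero_le_one (((0 : I) : ℝ) * (1 + z.2) - 1)))
      = ((f z.1).1.1 : Y) := by
    intro z
    simpa using (f z.1).2
  have ha : Continuous fun z : W × I => (f z.1).1.1 := by
    have : Continuous fun z : W × I => f z.1 := by fun_prop
    exact continuous_fst.comp (continuous_subtype_val.comp this)
  refine ⟨⟨_, continuous_pathsFrom_mk ha hγ h0⟩, fun x => ?_, fun z => ?_⟩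
  · refine Subtype.ext (Prod.ext rfl (ContinuousMap.ext fun s => ?_))
    have := s.2.2
    simp [this]
  · change (if (((1 : I) : ℝ)) * (1 + z.2) ≤ 1 then
        (f z.1).1.2 (Set.projIcc 0 1 zero_le_one (((1 : I) : ℝ) * (1 + z.2)))
      else H (z.1, Set.projIcc 0 1 zero_le_one (((1 : I) : ℝ) * (1 + z.2) - 1))) = H z
    obtain ⟨x, t⟩ := z
    split_ifs with ht
    · have ht0 : t = 0 := Subtype.ext (le_antisymm (by simpa using ht) t.2.1)
      subst ht0
      simp [h']
    · simp

/-- An acyclic cofibration of the m-structure that is the inclusion of a subspace is the inclusion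
of a strong deformation retract. -/
theorem isDeformationRetract_of_mAcyclicCofibrations (hA : mAcyclicCofibrations (inclusion A)) :
    IsDeformationRetract A := by
  have hw : weakHomotopyEquivalences (TopCat.ofHom (endPoint (A := A))) :=
    isWeakHomotopyEquiv_of_comp isWeakHomotopyEquiv_constPath hA.2
  have := hA.1 _ ⟨hurewiczFibrations_endPoint, hw⟩
  -- A lift in this square chooses for each `y` a path from `A` to `y`, constant when `y` is in `A`;
  -- the reversed paths form the deformation.
  have sq : CommSq (TopCat.ofHom (constPath (A := A))) (inclusion A)
    (TopCat.ofHom (endPoint (A := A))) (𝟙 _) := ⟨rfl⟩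
  obtain ⟨⟨l, hl, hl'⟩⟩ := (this.sq_hasLift sq).exists_lift
  have h1 : ∀ a : A, l.hom (a : Y) = constPath a := fun a => congr($(hl).hom a)
  have h2 : ∀ y : Y, endPoint (l.hom y) = y := fun y => congr($(hl').hom y)
  have hc : Continuous fun y : Y => (l.hom y).1 := continuous_subtype_val.comp l.hom.continuous
  refine ⟨⟨fun y => (l.hom y).1.1, continuous_fst.comp hc⟩,
    fun a => by simp only [ContinuousMap.coe_mk, h1]; rfl,
    homotopicRel_of_continuous (fun q => (l.hom q.2).1.2 (σ q.1)) ?_ ?_ ?_ ?_⟩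
  · exact (continuous_snd.comp (hc.comp continuous_snd)).eval (by fun_prop)
  · intro y
    simp only [unitInterval.symm_zero]
    exact h2 y
  · intro y
    simpa using (l.hom y).2
  · intro t a ha
    simp only [h1 ⟨a, ha⟩]
    rfl

/-! ### Closed cofibrations that are homotopy equivalences -/

/-- The inclusion of a subspace with the homotopy extension property that is a homotopy equivalence
is the inclusion of a strong deformation retract. -/
theorem isDeformationRetract_of_hAcyclicCofibrations (hA : hAcyclicCofibrations (inclusion A)) :
    IsDeformationRetract A := by
  obtain ⟨⟨-, hep⟩, e, he⟩ := hA
  have hei : ∀ a : A, e.toFun a = (a : Y) := fun a => congr($he a)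
  obtain ⟨L⟩ := e.left_inv
  obtain ⟨R⟩ := e.right_inv
  -- Extending the homotopy `L` from `A` to `Y` deforms the homotopy inverse into a retraction.
  obtain ⟨K, hK0, hK⟩ := hep (TopCat.of A) e.invFun ⟨fun q : A × I => L (q.2, q.1), by
    exact L.continuous.comp continuous_swap⟩ (fun a => by
      exact (L.apply_zero a).trans (congrArg e.invFun (hei a)))
  let r : C(Y, A) := ⟨fun y => K (y, 1), by fun_prop⟩
  have hr : ∀ a : A, r a = a := fun a => (hK a 1).trans (by simp)
  let i : C(A, Y) := ⟨Subtype.val, continuous_subtype_val⟩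
  have hir : (ContinuousMap.id Y).Homotopic (i.comp r) := by
    refine (ContinuousMap.Homotopic.symm ⟨R⟩).trans ?_
    refine ⟨⟨⟨fun q => i (K (q.2, q.1)), by fun_prop⟩, fun y => ?_, fun y => rfl⟩⟩
    exact (congrArg i (hK0 y)).trans (hei _).symm
  obtain ⟨Φ⟩ := hir
  have hrr : ∀ y, r (r y : Y) = r y := fun y => hr (r y)
  let tent : I → I := fun s => Set.projIcc 0 1 zero_le_one (1 - |2 * (s : ℝ) - 1|)
  have htent : Continuous tent := continuous_projIcc.comp (by fun_prop)
  have tent_zero : tent 0 = 0 := by simp [tent]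
  have tent_one : tent 1 = 0 := by simp [tent]; norm_num
  -- Follow `Φ` from `y` to `r y`, then `Φ` at `r y` backwards: the path ends at `r y`, and over `A`
  -- it runs out and back along the same track.
  have hq : Continuous fun z : Y × I => if (z.2 : ℝ) ≤ 1 / 2 then Φ (tent z.2, z.1)
      else Φ (tent z.2, (r z.1 : Y)) := by
    refine Continuous.if_le (by fun_prop) (by fun_prop) (by fun_prop) continuous_const ?_
    rintro ⟨y, s⟩ hs
    have hs' : (s : ℝ) = 1 / 2 := hs
    have : tent s = 1 := by simp [tent, hs']
    simp only [this, Φ.apply_one]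
    exact congrArg Subtype.val (hrr y).symm
  -- Over `A` the path contracts to a constant by scaling `tent`; extend this contraction to `Y`.
  -- The other three sides of the resulting square (`H1`, `H2`, `H3` reversed) are constant on `A`.
  obtain ⟨K, hK0, hK⟩ := hep (TopCat.of C(I, Y)) (ContinuousMap.curry ⟨_, hq⟩)
    (ContinuousMap.curry ⟨fun z : (A × I) × I => Φ (σ z.1.2 * tent z.2, (z.1.1 : Y)), by
      fun_prop⟩) (fun a => by
        refine ContinuousMap.ext fun s => ?_
        change Φ (σ 0 * tent s, (a : Y)) = if (s : ℝ) ≤ 1 / 2 then Φ (tent s, (a : Y))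
          else Φ (tent s, (r a : Y))
        simp [hr a])
  let K' : C(Y × I, C(I, Y)) := K
  have hK0' : ∀ y s, K' (y, 0) s = if (s : ℝ) ≤ 1 / 2 then Φ (tent s, y)
      else Φ (tent s, (r y : Y)) := fun y s => congr($(hK0 y) s)
  have hKA : ∀ y ∈ A, ∀ t s, K' (y, t) s = Φ (σ t * tent s, y) :=
    fun y hy t s => congr($(hK ⟨y, hy⟩ t) s)
  have H1 : (ContinuousMap.id Y).HomotopicRel ⟨fun y => K' (y, 1) 0, by fun_prop⟩ A :=
    homotopicRel_of_continuous (fun z => K' (z.2, z.1) 0) (by fun_prop)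
      (fun y => by simp [hK0', tent_zero]) (fun y => rfl)
      fun t y hy => by simp [hKA y hy, tent_zero]
  have H2 : ContinuousMap.HomotopicRel ⟨fun y => K' (y, 1) 0, by fun_prop⟩
      ⟨fun y => K' (y, 1) 1, by fun_prop⟩ A :=
    homotopicRel_of_continuous (fun z => K' (z.2, 1) z.1) (by fun_prop)
      (fun y => rfl) (fun y => rfl) fun t y hy => by simp [hKA y hy]
  have H3 : (i.comp r).HomotopicRel ⟨fun y => K' (y, 1) 1, by fun_prop⟩ A :=
    homotopicRel_of_continuous (fun z => K' (z.2, z.1) 1) (by fun_prop)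
      (fun y => by
        have : ¬ (1 : ℝ) ≤ 1 / 2 := by norm_num
        simp only [hK0', tent_one, Set.Icc.coe_one, if_neg this, Φ.apply_zero]
        rfl) (fun y => rfl)
      fun t y hy => by
        simp only [hKA y hy, tent_one, mul_zero, Φ.apply_zero]
        exact congrArg Subtype.val (hr ⟨y, hy⟩).symm
  exact ⟨r, hr, (H1.trans H2).trans H3.symm⟩

end Deformation

/-! ### The parametric Oka property -/

section Oka

variable {E : Type*} [NormedAddCommGroup E] [NormedSpace ℂ E]
  {F : Type*} [NormedAddCommGroup F] [NormedSpace ℂ F]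
  (S : Type u) [TopologicalSpace S] [ChartedSpace E S]
  (X : Type v) [TopologicalSpace X] [ChartedSpace F X]

theorem parametricOka_of_isDeformationRetract
    (h : IsDeformationRetract (holomorphicMaps E F S X))
    (P : Type w) [TopologicalSpace P] (Q : Set P) : ParametricOka E F S X P Q := by
  obtain ⟨r, hr, ⟨H⟩⟩ := h
  refine fun f hf => ⟨⟨fun z => H (z.2, f z.1), by fun_prop⟩, fun p => ?_, fun q hq t => ?_,
    fun p => ?_⟩
  · simp
  · exact H.eq_fst t (hf q hq)
  · simp

/-- The parameter space is `C(S, X)` itself with the identity map; `ULift` only adjusts the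
universe. -/
theorem isDeformationRetract_of_parametricOka
    (h : ∀ (P : Type (max u v w)) [TopologicalSpace P] (Q : Set P), ParametricOka E F S X P Q) :
    IsDeformationRetract (holomorphicMaps E F S X) := by
  obtain ⟨G, hG0, hGQ, hG1⟩ := h (ULift.{w} C(S, X)) (ULift.down ⁻¹' holomorphicMaps E F S X)
    ⟨ULift.down, continuous_uliftDown⟩ (fun q hq => hq)
  refine ⟨⟨fun f => ⟨G (⟨f⟩, 1), hG1 _⟩, ?_⟩, fun a => Subtype.ext (hGQ ⟨a⟩ a.2 1),
    homotopicRel_of_continuous (fun z => G (⟨z.2⟩, z.1)) ?_ (fun f => hG0 ⟨f⟩) (fun f => rfl)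
      fun t f hf => hGQ ⟨f⟩ hf t⟩
  · exact (G.continuous.comp (continuous_uliftUp.prodMk continuous_const)).subtype_mk _
  · exact G.continuous.comp ((continuous_uliftUp.comp continuous_snd).prodMk continuous_fst)

end Oka

/-- The topology is uniform convergence on compact sets, and an exhaustion of `S` by countably many
of them suffices. -/
theorem metrizableSpace_continuousMap (S : Type u) [TopologicalSpace S]
    [LocallyCompactSpace S] [SigmaCompactSpace S]
    (X : Type v) [TopologicalSpace X] [TopologicalSpace.MetrizableSpace X] :
    TopologicalSpace.MetrizableSpace C(S, X) := by
  let := TopologicalSpace.metrizableSpaceMetric X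
  infer_instance

end OkaReformulation

theorem mainTheorem9
    {E : Type*} [NormedAddCommGroup E] [NormedSpace ℂ E] [FiniteDimensional ℂ E]
    {F : Type*} [NormedAddCommGroup F] [NormedSpace ℂ F] [FiniteDimensional ℂ F]
    (S : Type u) [TopologicalSpace S] [T2Space S] [SecondCountableTopology S]
    [ChartedSpace E S] [IsManifold 𝓘(ℂ, E) 1 S]
    (X : Type v) [TopologicalSpace X] [T2Space X] [SecondCountableTopology X]
    [ChartedSpace F X] [IsManifold 𝓘(ℂ, F) 1 X] :
    List.TFAE [
      ∀ (P : Type (max u v w)) [TopologicalSpace P] (Q : Set P),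
        OkaReformulation.ParametricOka E F S X P Q,
      OkaReformulation.IsDeformationRetract (OkaReformulation.holomorphicMaps E F S X),
      OkaReformulation.hAcyclicCofibrations
        (OkaReformulation.inclusion (OkaReformulation.holomorphicMaps E F S X)),
      OkaReformulation.mAcyclicCofibrations
        (OkaReformulation.inclusion (OkaReformulation.holomorphicMaps E F S X))] := by
  -- Finite-dimensional models make the manifolds locally compact. With the Hausdorff and
  -- countability axioms, `S` is σ-compact and `X` metrizable.
  have : ProperSpace E := FiniteDimensional.proper ℂ E
  have : ProperSpace F := FiniteDimensional.proper ℂ F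
  have : LocallyCompactSpace S := ChartedSpace.locallyCompactSpace E S
  have : LocallyCompactSpace X := ChartedSpace.locallyCompactSpace F X
  have : TopologicalSpace.MetrizableSpace X :=
    TopologicalSpace.metrizableSpace_of_t3_secondCountable X
  have := OkaReformulation.metrizableSpace_continuousMap S X
  tfae_have 1 → 2 := OkaReformulation.isDeformationRetract_of_parametricOka.{u, v, w} S X
  tfae_have 2 → 1 := fun h P _ Q =>
    OkaReformulation.parametricOka_of_isDeformationRetract S X h P Q
  tfae_have 2 → 3 := fun h => ⟨h.hCofibrations, h.homotopyEquivalences⟩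
  tfae_have 3 → 2 := OkaReformulation.isDeformationRetract_of_hAcyclicCofibrations
  tfae_have 2 → 4 := fun h => ⟨h.mCofibrations, h.weakHomotopyEquivalences⟩
  tfae_have 4 → 2 := OkaReformulation.isDeformationRetract_of_mAcyclicCofibrations
  tfae_finish
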